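/- For a non-negative integer $k$ let $\Delta_k$ be the set of all subsets of $\mathbb{N}$ with at most $k$ elements, equipped with the symmetric difference metric $d(\sigma,\tau)=|\sigma\bigtriangleup\tau|$. For an ordinal $\alpha$ let $C([0,\alpha])$ be the Banach space of continuous real-valued functions, with the supremum norm, on the compact space $[0,\alpha]$ of ordinals with the order topology. For an injective map $f\colon M\to N$ of metric spaces put \[ \mathrm{dist}(f)=\Big(\sup_{x\ne y\in M}\frac{d_N(f(x),f(y))}{d_M(x,y)}\Big)\Big(\sup_{x\ne y\in M}\frac{d_M(x,y)}{d_N(f(x),f(y))}\Big)\in[0,\infty], \] and put $\mathrm{dist}(f)=\infty$ if $f$ is not injective. Let $c_N(M)=\inf\{C\ge 1 : \text{there is } f\colon M\to N \text{ with } \mathrm{dist}(f)\le C\}$. Theorem. Let $1\le r\le k$ be integers. Then there is a map $\varphi_{k,r}\colon\Delta_k\to C([0,\omega^r])$ with $\mathrm{dist}(\varphi_{k,r})\le k/r$. In particular, $\Delta_k$ embeds isometrically into $C([0,\omega^k])$. Moreover, $c_{C([0,\omega^r])}(\Delta_k)\le\min\{k/r,\,2\}$. -/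

import Mathlib

open scoped ENNReal NNReal

/-- `Δ_k`: the finite subsets of `ℕ` with at most `k` elements. -/
def Delta (k : ℕ) : Type := {s : Finset ℕ // s.card ≤ k}

/-- The symmetric difference metric `d(σ, τ) = |σ ∆ τ|` on `Δ_k`. -/
noncomputable instance Delta.instMetricSpace (k : ℕ) : MetricSpace (Delta k) where
  dist σ τ := ((symmDiff σ.1 τ.1).card : ℝ)
  dist_self σ := by simp
  dist_comm σ τ := by simp [symmDiff_comm]
  dist_triangle σ τ ρ := by
    have h : (symmDiff σ.1 ρ.1).card ≤ (symmDiff σ.1 τ.1).card + (symmDiff τ.1 ρ.1).card :=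
      (Finset.card_le_card (symmDiff_triangle σ.1 τ.1 ρ.1)).trans (Finset.card_union_le _ _)
    exact_mod_cast h
  eq_of_dist_eq_zero := by
    intro σ τ h
    have h' : (symmDiff σ.1 τ.1).card = 0 := by exact_mod_cast h
    exact Subtype.ext (symmDiff_eq_bot.mp (Finset.card_eq_zero.mp h'))

/-- The Banach space `C([0, α])` of continuous real-valued functions, with the supremum norm, on
the interval `[0, α]` of ordinals with its order topology. -/
abbrev COrd (α : Ordinal.{0}) : Type 1 := C(Set.Icc (0 : Ordinal.{0}) α, ℝ)

open Classical in
/-- The distortion `dist(f) = ‖f‖_Lip * ‖f⁻¹‖_Lip` of a map between metric spaces, with values in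
`[0, ∞]`.  It is `∞` when `f` is not injective (so that `f⁻¹` does not exist); this also rules out
the convention `0 * ∞ = 0` for constant maps. -/
noncomputable def distortion {M N : Type*} [MetricSpace M] [MetricSpace N] (f : M → N) : ℝ≥0∞ :=
  if Function.Injective f then
    (⨆ (x : M) (y : M) (_ : x ≠ y), edist (f x) (f y) / edist x y) *
      (⨆ (x : M) (y : M) (_ : x ≠ y), edist x y / edist (f x) (f y))
  else ∞

/-- The `N`-distortion of `M`: the infimum of the `C ∈ [1, ∞)` such that some map `M → N` has
distortion at most `C` (and `∞` if there is no such `C`). -/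
noncomputable def spaceDistortion (N M : Type*) [MetricSpace M] [MetricSpace N] : ℝ≥0∞ :=
  ⨅ (C : ℝ≥0) (_ : 1 ≤ C) (_ : ∃ f : M → N, distortion f ≤ C), (C : ℝ≥0∞)

/-!
The space `Δ_k` sits in `C([0, ω ^ r])` through signs. There are clopen sets `U n ⊆ [0, ω ^ r]`,
`n : ℕ`, such that every `A ⊆ ℕ` with at most `r` elements is the set of all `n` with `x ∈ U n`, for
some `x` (`exists_isShattering`); this is the part of `[0, ω ^ r] ≅ Δ_r` that is needed. Let `ε n` be
the continuous function that is `1` on `U n` and `-1` off it. The map `σ ↦ ∑ n ∈ σ, ε n` is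
`1`-Lipschitz. For sets with `a = |σ \ τ| ≥ b = |τ \ σ|`, at a point where the sign is `1` on exactly
`min r b` elements of `τ \ σ` and `-1` at all other indices, the two images differ by
`a - b + 2 * min r b`, which is at least `(r / k) * (a + b)` because `r, b ≤ k`
(`IsShattering.exists_map_delta`). For `r = k` the map is an isometry.

The bound `2` holds because every countable metric space with bounded integer distances embeds into
`c₀` with distortion `2`, by the method of Kalton and Lancien (`exists_pointFinite_family`), and
because `c₀` is contained in `C(X)` as soon as `X` has infinitely many disjoint nonempty clopen sets
(`IsShattering.exists_two_embedding`).
-/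

/-! ### Shattering clopen sets of ordinals -/

open Ordinal in
/-- The combinatorial core of `exists_isShattering`: in `(0, ω ^ s]` there are finite unions of
half-open intervals `(a, b]`, one for each `n : ℕ` and given by the list `L n` of pairs `(a, b)`,
which shatter all sets of at most `s` indices. In the inductive step `(0, ω ^ (s + 1))` is cut into
the blocks `(ω ^ s * m, ω ^ s * (m + 1)]`, and the `m`-th block, a translate of `(0, ω ^ s]`, serves
the sets `A` with least element `m`. -/
theorem exists_finite_unions_Ioc (s : ℕ) :
    ∃ L : ℕ → List (Ordinal.{0} × Ordinal.{0}),
      (∀ n, ∀ p ∈ L n, p.2 ≤ ω ^ (s : Ordinal.{0})) ∧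
      ∀ A : Finset ℕ, A.card ≤ s → ∃ x : Ordinal.{0}, 0 < x ∧ x ≤ ω ^ (s : Ordinal.{0}) ∧
        ∀ n, (∃ p ∈ L n, x ∈ Set.Ioc p.1 p.2) ↔ n ∈ A := by
  induction s with
  | zero =>
    refine ⟨fun _ => [], by simp, fun A hA => ⟨1, by simp, by simp, fun n => ?_⟩⟩
    have : A = ∅ := by simpa using hA
    simp [this]
  | succ s ih =>
    obtain ⟨L, hL, hx⟩ := ih
    set w : Ordinal.{0} := ω ^ (s : Ordinal.{0})
    have hw0 : 0 < w := opow_pos _ omega0_pos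
    have hws : ω ^ ((s + 1 : ℕ) : Ordinal.{0}) = w * ω := by
      rw [Nat.cast_succ, opow_add, opow_one]
    have hlt (n : ℕ) : w * n + w < ω ^ ((s + 1 : ℕ) : Ordinal.{0}) := by
      rw [hws]
      have : w * n + w = w * ((n + 1 : ℕ) : Ordinal.{0}) := by
        rw [Nat.cast_succ, mul_add, mul_one]
      rw [this]
      exact (mul_lt_mul_iff_right₀ hw0).2 (natCast_lt_omega0 _)
    have hblock {m n : ℕ} {x : Ordinal.{0}} (h₁ : w * m < x) (h₂ : x ≤ w * n + w) : m ≤ n := by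
      by_contra h
      have h' : ((n + 1 : ℕ) : Ordinal.{0}) ≤ m := by exact_mod_cast Nat.lt_of_not_le h
      have := mul_le_mul_right h' w
      rw [Nat.cast_succ, mul_add, mul_one] at this
      exact absurd (h₁.trans_le (h₂.trans this)) (lt_irrefl _)
    -- The `n`-th set is all of the `n`-th block, and a copy of the old one in each earlier block.
    refine ⟨fun n => (w * n, w * n + w) :: (List.range n).flatMap fun m : ℕ =>
      (L n).map fun p => (w * (m : Ordinal.{0}) + p.1, w * (m : Ordinal.{0}) + p.2), ?_, ?_⟩
    · intro n p hp
      simp only [List.mem_cons, List.mem_flatMap, List.mem_range, List.mem_map] at hp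
      obtain rfl | ⟨m, -, q, hq, rfl⟩ := hp
      · exact (hlt n).le
      · exact (add_le_add_right (hL n q hq) _).trans (hlt m).le
    · intro A hA
      simp only [List.mem_cons, List.mem_flatMap, List.mem_range, List.mem_map, exists_eq_or_imp,
        Set.mem_Ioc]
      obtain rfl | hne := A.eq_empty_or_nonempty
      -- The empty set is realised by `ω ^ (s + 1)`, which lies in no block.
      · refine ⟨_, opow_pos _ omega0_pos, le_rfl, fun n => ?_⟩
        simp only [Finset.notMem_empty, iff_false]
        rintro (⟨-, h⟩ | ⟨_, ⟨m, -, q, hq, rfl⟩, -, h⟩)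
        · exact absurd h (hlt n).not_ge
        · exact absurd (h.trans (add_le_add_right (hL n q hq) _)) (hlt m).not_ge
      · set m := A.min' hne
        have hmA : m ∈ A := A.min'_mem hne
        obtain ⟨x, hx0, hxw, hxA⟩ := hx (A.erase m) (by
          rw [Finset.card_erase_of_mem hmA]; omega)
        have h₁ : w * m < w * m + x := by simpa using hx0
        have h₂ : w * m + x ≤ w * m + w := by simpa using hxw
        refine ⟨w * m + x, h₁.pos, h₂.trans (hlt m).le, fun n => ?_⟩
        constructor
        · rintro (⟨h, h'⟩ | ⟨_, ⟨j, hj, q, hq, rfl⟩, h, h'⟩)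
          · rwa [le_antisymm (hblock h h₂) (hblock h₁ h')]
          · have hjm : j = m := le_antisymm
              (hblock (lt_of_le_of_lt (le_self_add) h) h₂)
              (hblock h₁ (h'.trans (add_le_add_right (hL n q hq) _)))
            rw [hjm] at h h'
            exact Finset.mem_of_mem_erase
              ((hxA n).1 ⟨q, hq, by simpa using h, by simpa using h'⟩)
        · intro hn
          obtain rfl | hnm := eq_or_ne n m
          · exact Or.inl ⟨h₁, h₂⟩
          · obtain ⟨q, hq, h, h'⟩ := (hxA n).2 (Finset.mem_erase.2 ⟨hnm, hn⟩)
            exact Or.inr ⟨_, ⟨m, lt_of_le_of_ne (A.min'_le n hn) hnm.symm, q, hq, rfl⟩,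
              by simpa using h, by simpa using h'⟩

theorem Ordinal.isClopen_Ioc (a b : Ordinal.{0}) : IsClopen (Set.Ioc a b) := by
  rw [← Set.Ioi_inter_Iic]
  refine IsClopen.inter ⟨?_, isOpen_Ioi⟩ ⟨isClosed_Iic, ?_⟩
  · rw [← Order.Ici_succ]; exact isClosed_Ici
  · rw [← Order.Iio_succ]; exact isOpen_Iio

/-- A sequence of clopen sets `U n` which shatters the finite sets of size at most `r`: each set `A`
of at most `r` indices is exactly the set of indices `n` with `x ∈ U n`, for some point `x`. Such a
sequence amounts to a continuous map from `X` to the Cantor space of subsets of `ℕ` whose image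
contains `Δ_r`. -/
def IsShattering {X : Type*} [TopologicalSpace X] (U : ℕ → Set X) (r : ℕ) : Prop :=
  (∀ n, IsClopen (U n)) ∧ ∀ A : Finset ℕ, A.card ≤ r → ∃ x, ∀ n, x ∈ U n ↔ n ∈ A

theorem exists_isShattering (s : ℕ) :
    ∃ U : ℕ → Set (Set.Icc (0 : Ordinal.{0}) (Ordinal.omega0 ^ (s : Ordinal.{0}))),
      IsShattering U s := by
  obtain ⟨L, -, hA⟩ := exists_finite_unions_Ioc s
  refine ⟨fun n => Subtype.val ⁻¹' ⋃ p ∈ {p | p ∈ L n}, Set.Ioc p.1 p.2, fun n => ?_, fun A h => ?_⟩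
  · refine IsClopen.preimage ?_ continuous_subtype_val
    exact (List.finite_toSet (L n)).isClopen_biUnion fun p _ => Ordinal.isClopen_Ioc _ _
  · obtain ⟨x, -, hx, hxA⟩ := hA A h
    refine ⟨⟨x, zero_le, hx⟩, fun n => ?_⟩
    rw [← hxA n]
    simp only [Set.mem_preimage, Set.mem_iUnion, Set.mem_ofPred_eq, exists_prop]

/-! ### Embedding into `c₀` with distortion two -/

/-- A `1`-Lipschitz bump of height `a` on `U`, which decays at unit speed. The function
`max 0 (a - infDist · U)` does this for nonempty `U`; for empty `U` the value `infDist · ∅ = 0` would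
be misleading, and the bump is `0`. -/
theorem exists_nonneg_bump {M : Type*} [MetricSpace M] (U : Set M) {a : ℝ} (ha : 0 ≤ a) :
    ∃ f : M → ℝ, (∀ x, 0 ≤ f x) ∧ (∀ x y, f x - f y ≤ dist x y) ∧ (∀ x ∈ U, f x = a) ∧
      ∀ z, 0 < f z → ∀ ε > 0, ∃ u ∈ U, f z + dist z u < a + ε := by
  obtain rfl | hU := U.eq_empty_or_nonempty
  · exact ⟨fun _ => 0, by simp, by simp, by simp, by simp⟩
  · refine ⟨fun z => max 0 (a - Metric.infDist z U), fun x => le_max_left _ _, fun x y => ?_,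
      fun x hx => ?_, fun z hz ε hε => ?_⟩
    · have h := Metric.infDist_le_infDist_add_dist (s := U) (x := y) (y := x)
      rw [dist_comm] at h
      rw [sub_le_iff_le_add]
      refine max_le (add_nonneg dist_nonneg (le_max_left _ _)) ?_
      have := le_max_right 0 (a - Metric.infDist y U)
      linarith
    · simp [Metric.infDist_zero_of_mem hx, ha]
    · have hz' : 0 < a - Metric.infDist z U := by simpa using hz
      obtain ⟨u, hu, h⟩ := (Metric.infDist_lt_iff hU).1
        (show Metric.infDist z U < Metric.infDist z U + ε by linarith)
      refine ⟨u, hu, ?_⟩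
      simp only [max_eq_right hz'.le]
      linarith

/-- If the sets `U` and `V` are at distance at least `a + b`, then a bump of height `a` on `U` minus a
bump of height `b` on `V` is still `1`-Lipschitz. It lives within distance `a` of `U` and within
distance `b` of `V`. -/
theorem exists_bump {M : Type*} [MetricSpace M] (U V : Set M) {a b : ℝ} (ha : 0 ≤ a) (hb : 0 ≤ b)
    (hUV : ∀ u ∈ U, ∀ v ∈ V, a + b ≤ dist u v) :
    ∃ f : M → ℝ, (∀ x y, |f x - f y| ≤ dist x y) ∧ (∀ x ∈ U, f x = a) ∧ (∀ x ∈ V, f x = -b) ∧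
      ∀ z, f z ≠ 0 → (∃ u ∈ U, dist z u < a) ∨ ∃ v ∈ V, dist z v < b := by
  obtain ⟨f, hf0, hf, hfU, hfs⟩ := exists_nonneg_bump U ha
  obtain ⟨g, hg0, hg, hgV, hgs⟩ := exists_nonneg_bump V hb
  have hfs' (z : M) (hz : 0 < f z) : ∃ u ∈ U, dist z u < a := by
    obtain ⟨u, hu, h⟩ := hfs z hz (f z) hz
    exact ⟨u, hu, by linarith⟩
  have hgs' (z : M) (hz : 0 < g z) : ∃ v ∈ V, dist z v < b := by
    obtain ⟨v, hv, h⟩ := hgs z hz (g z) hz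
    exact ⟨v, hv, by linarith⟩
  have hlip (x y : M) : f x - g x - (f y - g y) ≤ dist x y := by
    have hfxy := hf x y
    have hgyx := hg y x
    rw [dist_comm] at hgyx
    obtain h | hx := (hf0 x).eq_or_lt
    · linarith [hf0 y]
    obtain h | hy := (hg0 y).eq_or_lt
    · linarith [hg0 x]
    -- Here `x` lies near `U` and `y` lies near `V`, so that the gap between `U` and `V` counts.
    refine le_of_forall_pos_le_add fun ε hε => ?_
    obtain ⟨u, hu, h₁⟩ := hfs x hx (ε / 2) (by positivity)
    obtain ⟨v, hv, h₂⟩ := hgs y hy (ε / 2) (by positivity)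
    have := dist_triangle4 u x y v
    rw [dist_comm u x] at this
    linarith [hUV u hu v hv, hg0 x, hf0 y]
  refine ⟨fun z => f z - g z, fun x y => ?_, fun x hx => ?_, fun x hx => ?_, fun z hz => ?_⟩
  · rw [abs_sub_le_iff]
    exact ⟨hlip x y, dist_comm x y ▸ hlip y x⟩
  · obtain h | h := (hg0 x).eq_or_lt
    · simp [← h, hfU x hx]
    · obtain ⟨v, hv, h'⟩ := hgs' x h
      linarith [hUV x hx v hv]
  · obtain h | h := (hf0 x).eq_or_lt
    · simp [← h, hgV x hx]
    · obtain ⟨u, hu, h'⟩ := hfs' x h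
      rw [dist_comm] at h'
      linarith [hUV u hu x hx]
  · obtain h | h := (hf0 z).eq_or_lt
    · refine Or.inr (hgs' z ((hg0 z).lt_of_ne fun h' => hz ?_))
      simp [← h, ← h']
    · exact Or.inl (hfs' z h)

/-- The embedding of a countable metric space `M`, with bounded integer distances, into `c₀` with
distortion `2`, in coordinates: a sequence of `1`-Lipschitz functions, of which only finitely many
are nonzero at each point, and which recover all distances up to the factor `2`.

Let `e 0, e 1, …` enumerate `M`. For a pair `x, y` at distance `d` let `n` be least such that some
`e i, e j` with `i, j ≤ n` satisfy `2 * (dist x (e i) + dist y (e j)) ≤ d`. By minimality there are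
`a, b ≥ 0` with `a + b = d / 2` such that `x` has distance at least `a`, and `y` at least `b`, from
`e 0, …, e (n - 1)`. The pair is separated by a difference of bumps of heights `a` and `b` on sets
`U ∋ x` and `V ∋ y` that depend only on `n`, `i`, `j`, `a`, `b`, `d`, `r = dist x (e i)` and
`s = dist y (e j)`; the conditions defining `U` and `V` keep the bumps away from
`e 0, …, e (n - 1)` and force `dist U V ≥ d - (r + s) ≥ d / 2`. Each `n` admits only finitely many
values of these parameters, so only finitely many of these functions are nonzero at `e m`. -/
theorem exists_pointFinite_family {M : Type*} [MetricSpace M] [Countable M] [Nonempty M]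
    (δ : M → M → ℕ) (hδ : ∀ x y, dist x y = δ x y) (B : ℕ) (hB : ∀ x y, δ x y ≤ B) :
    ∃ f : ℕ → M → ℝ, (∀ i x y, |f i x - f i y| ≤ dist x y) ∧
      (∀ x, {i | f i x ≠ 0}.Finite) ∧ ∀ x y, ∃ i, dist x y ≤ 2 * |f i x - f i y| := by
  obtain ⟨e, he⟩ := exists_surjective_nat M
  have htri (x y z : M) : δ x z ≤ δ x y + δ y z := by
    have := dist_triangle x y z
    rw [hδ, hδ, hδ] at this
    exact_mod_cast this
  have hcomm (x y : M) : δ x y = δ y x := by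
    have := dist_comm x y
    rw [hδ, hδ] at this
    exact_mod_cast this
  have hself (x : M) : δ x x = 0 := by
    have := dist_self x
    rw [hδ] at this
    exact_mod_cast this
  -- The two sets for the bumps are `U n i j r s d h` and `U n j i s r d (d - h)`; the heights of the
  -- bumps are `h / 2` and `(d - h) / 2`.
  let U (n i j r s d h : ℕ) : Set M :=
    {x | δ x (e i) ≤ r ∧ d ≤ δ x (e j) + s ∧ ∀ l < n, h ≤ 2 * δ x (e l)}
  have key (p : Fin 7 → ℕ) : ∃ f : M → ℝ, (∀ x y, |f x - f y| ≤ dist x y) ∧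
      (∀ m, f (e m) ≠ 0 → p ≤ fun _ => m + B) ∧
      ∀ n i j r s d h : ℕ, p = ![n, i, j, r, s, d, h] →
        i ≤ n → j ≤ n → r ≤ B → s ≤ B → d ≤ B → h ≤ d → 2 * (r + s) ≤ d →
        ∀ x ∈ U n i j r s d h, ∀ y ∈ U n j i s r d (d - h), (d : ℝ) ≤ 2 * |f x - f y| := by
    by_cases hp : ∃ n i j r s d h : ℕ, p = ![n, i, j, r, s, d, h] ∧
        i ≤ n ∧ j ≤ n ∧ r ≤ B ∧ s ≤ B ∧ d ≤ B ∧ h ≤ d ∧ 2 * (r + s) ≤ d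
    · obtain ⟨n, i, j, r, s, d, h, rfl, hi, hj, hr, hs, hd, hh, hrs⟩ := hp
      obtain ⟨f, hf, hfU, hfV, hf0⟩ := exists_bump (U n i j r s d h) (U n j i s r d (d - h))
        (a := h / 2) (b := (d - h : ℕ) / 2) (by positivity) (by positivity) (by
          rintro u ⟨hu₁, hu₂, -⟩ v ⟨hv₁, hv₂, -⟩
          -- The gap is at least `d - 2 * s` and at least `d - 2 * r`: take the mean of the two.
          have h₁ := htri u v (e j)
          have h₂ := htri v u (e i)
          rw [hcomm v u] at h₂
          have h₃ : d ≤ 2 * δ u v := by omega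
          rw [hδ, Nat.cast_sub hh]
          have : (d : ℝ) ≤ 2 * δ u v := by exact_mod_cast h₃
          linarith)
      refine ⟨f, hf, fun m hm => ?_, ?_⟩
      · have hnm : n ≤ m := by
          by_contra hnm
          obtain ⟨u, hu, hlt⟩ | ⟨u, hu, hlt⟩ := hf0 _ hm
          all_goals
            have h₁ := hu.2.2 m (not_le.1 hnm)
            rw [dist_comm, hδ, lt_div_iff₀ two_pos] at hlt
            norm_cast at hlt
            omega
        intro t
        fin_cases t <;> simp <;> omega
      · rintro n' i' j' r' s' d' h' heq - - - - - - - x hx y hy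
        simp only [Matrix.vecCons_inj, and_true] at heq
        obtain ⟨rfl, rfl, rfl, rfl, rfl, rfl, rfl⟩ := heq
        rw [hfU x hx, hfV y hy, Nat.cast_sub hh]
        have := le_abs_self ((h : ℝ) / 2 - -(((d : ℝ) - h) / 2))
        linarith
    · refine ⟨fun _ => 0, by simp, by simp, ?_⟩
      intro n i j r s d h hp' hi hj hr hs hd hh hrs
      exact (hp ⟨n, i, j, r, s, d, h, hp', hi, hj, hr, hs, hd, hh, hrs⟩).elim
  choose f hf hf0 hfd using key
  obtain ⟨g⟩ : Nonempty ((Fin 7 → ℕ) ≃ ℕ) := inferInstance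
  refine ⟨fun q => f (g.symm q), fun q => hf _, fun x => ?_, fun x y => ?_⟩
  · obtain ⟨m, rfl⟩ := he x
    refine ((Set.finite_Iic (fun _ : Fin 7 => m + B)).image g).subset fun q hq => ?_
    exact ⟨g.symm q, hf0 _ m hq, by simp⟩
  · have hex : ∃ n, ∃ i ≤ n, ∃ j ≤ n, 2 * (δ x (e i) + δ y (e j)) ≤ δ x y := by
      obtain ⟨i, rfl⟩ := he x
      obtain ⟨j, rfl⟩ := he y
      exact ⟨max i j, i, le_max_left _ _, j, le_max_right _ _, by simp [hself]⟩
    classical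
    let n := Nat.find hex
    obtain ⟨i, hi, j, hj, hij⟩ : ∃ i ≤ n, ∃ j ≤ n, 2 * (δ x (e i) + δ y (e j)) ≤ δ x y :=
      Nat.find_spec hex
    have hmin (a b : ℕ) (ha : a < n) (hb : b < n) : δ x y < 2 * (δ x (e a) + δ y (e b)) := by
      have := Nat.find_min hex (m := max a b) (max_lt ha hb)
      push Not at this
      exact this a (le_max_left _ _) b (le_max_right _ _)
    obtain ⟨h, hh, hx, hy⟩ : ∃ h ≤ δ x y, (∀ l < n, h ≤ 2 * δ x (e l)) ∧
        ∀ l < n, δ x y - h ≤ 2 * δ y (e l) := by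
      obtain hn | hn := Nat.eq_zero_or_pos n
      · exact ⟨0, by simp, by simp, by simp [hn]⟩
      -- The bump at `x` gets the largest height that `e 0, …, e (n - 1)` and `d` allow.
      · obtain ⟨a, ha, hamin⟩ := Finset.exists_min_image (Finset.range n) (fun l => δ x (e l))
          ⟨0, by simpa using hn⟩
        simp only [Finset.mem_range] at ha hamin
        refine ⟨min (δ x y) (2 * δ x (e a)), min_le_left _ _, fun l hl => ?_, fun l hl => ?_⟩
        · have := hamin l hl
          omega
        · have := hmin a l ha hl
          omega
    refine ⟨g ![n, i, j, δ x (e i), δ y (e j), δ x y, h], ?_⟩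
    simp only [Equiv.symm_apply_apply]
    rw [hδ]
    have h₁ := htri x (e j) y
    have h₂ := htri y (e i) x
    rw [hcomm y x, hcomm (e i) x] at h₂
    rw [hcomm (e j) y] at h₁
    exact hfd _ n i j _ _ _ h rfl hi hj (hB _ _) (hB _ _) (hB _ _) hh hij x
      ⟨le_rfl, by omega, hx⟩ y ⟨le_rfl, by omega, hy⟩

/-! ### Distortion -/

theorem distortion_le_of_lipschitz_antilipschitz {M N : Type*} [MetricSpace M] [MetricSpace N]
    {f : M → N} {C : ℝ≥0} (hf : LipschitzWith 1 f) (hf' : AntilipschitzWith C f) :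
    distortion f ≤ C := by
  rw [distortion, if_pos hf'.injective, ← one_mul (C : ℝ≥0∞)]
  gcongr
  · refine iSup_le fun x => iSup_le fun y => iSup_le fun _ => ENNReal.div_le_of_le_mul ?_
    simpa using hf x y
  · exact iSup_le fun x => iSup_le fun y => iSup_le fun _ => ENNReal.div_le_of_le_mul (hf' x y)

theorem spaceDistortion_le {M N : Type*} [MetricSpace M] [MetricSpace N] {C : ℝ≥0} (hC : 1 ≤ C)
    {f : M → N} (hf : distortion f ≤ C) : spaceDistortion N M ≤ C :=
  iInf_le_of_le C (iInf_le_of_le hC (iInf_le_of_le ⟨f, hf⟩ le_rfl))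

/-! ### Maps into spaces with shattering clopen sets -/

instance Delta.instCountable (k : ℕ) : Countable (Delta k) :=
  inferInstanceAs (Countable {s : Finset ℕ // s.card ≤ k})

instance Delta.instNonempty (k : ℕ) : Nonempty (Delta k) := ⟨⟨∅, by simp⟩⟩

theorem Delta.dist_eq {k : ℕ} (σ τ : Delta k) :
    dist σ τ = ((symmDiff σ.1 τ.1).card : ℝ) := rfl

theorem Finset.card_symmDiff_eq_add (s t : Finset ℕ) :
    (symmDiff s t).card = (s \ t).card + (t \ s).card :=
  Finset.card_union_of_disjoint disjoint_sdiff_sdiff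

section Shattering

variable {X : Type*} [TopologicalSpace X] {U : ℕ → Set X} {r : ℕ}

open Classical in
/-- The continuous signs `ε n = ± 1` attached to a shattering sequence. -/
theorem IsShattering.exists_sign (hU : IsShattering U r) :
    ∃ ε : ℕ → C(X, ℝ), ∀ n x, ε n x = if x ∈ U n then 1 else -1 :=
  ⟨fun n => ⟨fun x => if x ∈ U n then 1 else -1,
    continuous_const.if (fun x hx => by simp [(hU.1 n).frontier_eq] at hx) continuous_const⟩,
    fun _ _ => rfl⟩

variable [CompactSpace X]

/-- The map `σ ↦ ∑ n ∈ σ, ε n` from `Δ_k` to `C(X)` is `1`-Lipschitz and shrinks distances at most by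
the factor `r / k`. For `|τ \ σ| ≤ |σ \ τ|` the lower bound is seen at a point where `ε = 1` on `r`
elements of `τ \ σ` (on all of them, if there are fewer) and `ε = -1` on the rest of `σ ∆ τ`. -/
theorem IsShattering.exists_map_delta (hU : IsShattering U r) {k : ℕ} (hrk : r ≤ k) :
    ∃ φ : Delta k → C(X, ℝ), (∀ σ τ, dist (φ σ) (φ τ) ≤ dist σ τ) ∧
      ∀ σ τ, r * dist σ τ ≤ k * dist (φ σ) (φ τ) := by
  classical
  obtain ⟨ε, hε⟩ := hU.exists_sign
  have happ (σ τ : Delta k) (x : X) : (∑ n ∈ σ.1, ε n) x - (∑ n ∈ τ.1, ε n) x =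
      ∑ n ∈ σ.1 \ τ.1, ε n x - ∑ n ∈ τ.1 \ σ.1, ε n x := by
    rw [ContinuousMap.sum_apply, ContinuousMap.sum_apply, Finset.sum_sdiff_sub_sum_sdiff]
  have hbd (s : Finset ℕ) (x : X) : |∑ n ∈ s, ε n x| ≤ s.card := by
    refine (Finset.abs_sum_le_sum_abs _ _).trans ?_
    rw [Finset.cast_card]
    refine Finset.sum_le_sum fun n _ => ?_
    rw [hε]
    split_ifs <;> simp
  refine ⟨fun σ => ∑ n ∈ σ.1, ε n, fun σ τ => ?_, fun σ τ => ?_⟩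
  · rw [ContinuousMap.dist_le dist_nonneg]
    intro x
    rw [Real.dist_eq, happ, Delta.dist_eq, Finset.card_symmDiff_eq_add, Nat.cast_add]
    exact (abs_sub _ _).trans (add_le_add (hbd _ x) (hbd _ x))
  · wlog hστ : (τ.1 \ σ.1).card ≤ (σ.1 \ τ.1).card generalizing σ τ
    · have := this τ σ (by omega)
      rwa [dist_comm τ σ, dist_comm (∑ n ∈ τ.1, ε n)] at this
    obtain ⟨A, hA, hAc⟩ := Finset.exists_subset_card_eq (min_le_right r (τ.1 \ σ.1).card)
    obtain ⟨x, hx⟩ := hU.2 A (by omega)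
    have hσ : ∑ n ∈ σ.1 \ τ.1, ε n x = -((σ.1 \ τ.1).card : ℝ) := by
      rw [Finset.sum_congr rfl (g := fun _ => (-1 : ℝ)), Finset.sum_const, nsmul_eq_mul,
        mul_neg_one]
      intro n hn
      rw [hε, if_neg]
      rw [hx]
      exact fun h => (Finset.mem_sdiff.1 (hA h)).2 (Finset.mem_sdiff.1 hn).1
    have hτ : ∑ n ∈ τ.1 \ σ.1, ε n x = 2 * A.card - ((τ.1 \ σ.1).card : ℝ) := by
      have : ∀ n, ε n x = 2 * (if n ∈ A then 1 else 0) - 1 := fun n => by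
        rw [hε]
        simp only [hx]
        split_ifs <;> norm_num
      simp only [this, Finset.sum_sub_distrib, ← Finset.mul_sum, Finset.sum_ite_mem,
        Finset.inter_eq_right.2 hA, Finset.sum_const, nsmul_eq_mul, mul_one]
    have hd := ContinuousMap.dist_apply_le_dist (f := ∑ n ∈ σ.1, ε n) (g := ∑ n ∈ τ.1, ε n) x
    rw [Real.dist_eq, happ, hσ, hτ] at hd
    have hd' := (neg_le_abs _).trans hd
    refine le_trans ?_ (mul_le_mul_of_nonneg_left hd' (Nat.cast_nonneg k))
    rw [Delta.dist_eq, Finset.card_symmDiff_eq_add, hAc]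
    have hτk : (τ.1 \ σ.1).card ≤ k := (Finset.card_le_card Finset.sdiff_subset).trans τ.2
    generalize (τ.1 \ σ.1).card = b at *
    generalize (σ.1 \ τ.1).card = a at *
    have hrk' : (r : ℝ) ≤ k := by exact_mod_cast hrk
    have hba : (b : ℝ) ≤ a := by exact_mod_cast hστ
    have hbk : (b : ℝ) ≤ k := by exact_mod_cast hτk
    have hr0 : (0 : ℝ) ≤ r := r.cast_nonneg
    push_cast
    obtain h | h := le_total (r : ℝ) b
    · rw [min_eq_left h]
      nlinarith [mul_le_mul_of_nonneg_left hbk hr0,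
        mul_le_mul_of_nonneg_right hrk' (sub_nonneg.2 hba)]
    · rw [min_eq_right h]
      nlinarith [mul_le_mul_of_nonneg_right hrk' (by positivity : (0 : ℝ) ≤ a + b)]

/-- The functions of `exists_pointFinite_family` become the values on a sequence of disjoint nonempty
clopen sets, which spans a copy of `c₀` in `C(X)`. -/
theorem IsShattering.exists_two_embedding (hU : IsShattering U r) (hr : 1 ≤ r) {M : Type*}
    [MetricSpace M] [Countable M] [Nonempty M] (δ : M → M → ℕ) (hδ : ∀ x y, dist x y = δ x y)
    (B : ℕ) (hB : ∀ x y, δ x y ≤ B) :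
    ∃ φ : M → C(X, ℝ), (∀ x y, dist (φ x) (φ y) ≤ dist x y) ∧
      ∀ x y, dist x y ≤ 2 * dist (φ x) (φ y) := by
  classical
  obtain ⟨f, hf, hf0, hfd⟩ := exists_pointFinite_family δ hδ B hB
  -- Disjoint clopen sets; `W n` is nonempty since a point realising the singleton `{n}` lies in it.
  let W (n : ℕ) : Set X := U n \ ⋃ m ∈ Set.Iio n, U m
  have hW (n : ℕ) : IsClopen (W n) :=
    (hU.1 n).diff ((Set.finite_Iio n).isClopen_biUnion fun m _ => hU.1 m)
  have hWdisj {m n : ℕ} {p : X} (hm : p ∈ W m) (hn : p ∈ W n) : m = n := by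
    obtain h | h | h := lt_trichotomy m n
    · exact (hn.2 (Set.mem_biUnion h hm.1)).elim
    · exact h
    · exact (hm.2 (Set.mem_biUnion h hn.1)).elim
  have hWne (n : ℕ) : (W n).Nonempty := by
    obtain ⟨p, hp⟩ := hU.2 {n} (by simpa using hr)
    refine ⟨p, (hp n).2 (by simp), ?_⟩
    simp only [Set.mem_iUnion, not_exists, hp, Finset.mem_singleton]
    exact fun m hm => ne_of_lt hm
  let χ (n : ℕ) : C(X, ℝ) := ⟨fun p => if p ∈ W n then 1 else 0,
    continuous_const.if (fun x hx => by simp [(hW n).frontier_eq] at hx) continuous_const⟩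
  let φ (x : M) : C(X, ℝ) := ∑ n ∈ (hf0 x).toFinset, f n x • χ n
  have hφ (x : M) (p : X) : φ x p = ∑ n ∈ (hf0 x).toFinset, f n x * if p ∈ W n then 1 else 0 := by
    simp [φ, χ, ContinuousMap.sum_apply]
  have hφW (x : M) {p : X} {n : ℕ} (hp : p ∈ W n) : φ x p = f n x := by
    rw [hφ, Finset.sum_eq_single n]
    · simp [hp]
    · intro m _ hmn
      simp [show p ∉ W m from fun h => hmn (hWdisj h hp)]
    · intro hn
      simp at hn
      simp [hn]
  have hφ0 (x : M) {p : X} (hp : ∀ n, p ∉ W n) : φ x p = 0 := by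
    simp [hφ, hp]
  refine ⟨φ, fun x y => ?_, fun x y => ?_⟩
  · rw [ContinuousMap.dist_le dist_nonneg]
    intro p
    by_cases hp : ∃ n, p ∈ W n
    · obtain ⟨n, hp⟩ := hp
      rw [hφW x hp, hφW y hp]
      exact hf n x y
    · push Not at hp
      simp [hφ0 _ hp]
  · obtain ⟨n, hn⟩ := hfd x y
    obtain ⟨p, hp⟩ := hWne n
    have := ContinuousMap.dist_apply_le_dist (f := φ x) (g := φ y) p
    rw [hφW x hp, hφW y hp, Real.dist_eq] at this
    linarith

end Shattering

theorem mainTheorem3 (k r : ℕ) (hr : 1 ≤ r) (hrk : r ≤ k) :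
    (∃ φ : Delta k → COrd (Ordinal.omega0 ^ (r : Ordinal.{0})),
      distortion φ ≤ (k : ℝ≥0∞) / (r : ℝ≥0∞)) ∧
    (∃ ψ : Delta k → COrd (Ordinal.omega0 ^ (k : Ordinal.{0})), Isometry ψ) ∧
    spaceDistortion (COrd (Ordinal.omega0 ^ (r : Ordinal.{0}))) (Delta k) ≤
      min ((k : ℝ≥0∞) / (r : ℝ≥0∞)) 2 := by
  have hr0 : (0 : ℝ) < r := by exact_mod_cast hr
  have hk0 : (0 : ℝ) < k := hr0.trans_le (by exact_mod_cast hrk)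
  have hcast : ((k / r : ℝ≥0) : ℝ≥0∞) = (k : ℝ≥0∞) / (r : ℝ≥0∞) := by
    rw [ENNReal.coe_div (by exact_mod_cast hr0.ne')]
    simp
  obtain ⟨U, hU⟩ := exists_isShattering r
  have h₁ : ∃ φ : Delta k → COrd (Ordinal.omega0 ^ (r : Ordinal.{0})),
      distortion φ ≤ ((k / r : ℝ≥0) : ℝ≥0∞) := by
    obtain ⟨φ, hφ, hφ'⟩ := IsShattering.exists_map_delta hU hrk
    refine ⟨φ, distortion_le_of_lipschitz_antilipschitz
      (LipschitzWith.of_dist_le_mul fun σ τ => by simpa using hφ σ τ)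
      (AntilipschitzWith.of_le_mul_dist fun σ τ => ?_)⟩
    rw [NNReal.coe_div, NNReal.coe_natCast, NNReal.coe_natCast, div_mul_eq_mul_div,
      le_div_iff₀ hr0, mul_comm]
    exact hφ' σ τ
  refine ⟨hcast ▸ h₁, ?_, le_min ?_ ?_⟩
  · obtain ⟨V, hV⟩ := exists_isShattering k
    obtain ⟨ψ, hψ, hψ'⟩ := IsShattering.exists_map_delta hV le_rfl
    exact ⟨ψ, Isometry.of_dist_eq fun σ τ =>
      le_antisymm (hψ σ τ) (le_of_mul_le_mul_left (hψ' σ τ) hk0)⟩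
  · obtain ⟨φ, hφ⟩ := h₁
    rw [← hcast]
    refine spaceDistortion_le ?_ hφ
    rw [one_le_div (by exact_mod_cast hr0)]
    exact_mod_cast hrk
  · obtain ⟨φ, hφ, hφ'⟩ := IsShattering.exists_two_embedding hU hr (M := Delta k)
      (fun σ τ => (symmDiff σ.1 τ.1).card) Delta.dist_eq (k + k) fun σ τ => by
        rw [Finset.card_symmDiff_eq_add]
        exact add_le_add ((Finset.card_le_card Finset.sdiff_subset).trans σ.2)
          ((Finset.card_le_card Finset.sdiff_subset).trans τ.2)
    exact spaceDistortion_le (C := 2) one_le_two (distortion_le_of_lipschitz_antilipschitz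
      (LipschitzWith.of_dist_le_mul fun σ τ => by simpa using hφ σ τ)
      (AntilipschitzWith.of_le_mul_dist fun σ τ => by simpa using hφ' σ τ))
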